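/- All Hilbert spaces are complex and separable. A density operator on $\mathcal K$ is a nonzero positive trace-class operator (not necessarily of trace $1$); $DO(\mathcal K)$ is the set of these. It is pure if it is $|\psi\rangle\langle\psi|$ for some $\psi\ne0$. A measurement over $\mathcal K$ is a countable family $\langle L_i\rangle_{i\in I}$ of bounded operators with $\sum_i L_i^\dagger L_i=\mathrm{Id}$ in the weak operator topology. In state $\sigma$ it produces outcome $i$ with probability $\mathrm{Tr}(L_i\sigma L_i^\dagger)/\mathrm{Tr}(\sigma)$, and the post-measurement state is $L_i\sigma L_i^\dagger$. A quantum circuit over $\mathcal K$ consists of finitely many quantum registers whose tensor product is identified with $\mathcal K$, finitely many gates, each acting on some of the registers, classical channels between gates, and a schedule dividing the gates into consecutive bouts so that all quantum and classical prerequisites of a gate fire before it. Each gate $G$ has a finite nonempty set of measurements over its registers, with disjoint outcome sets, and a selection function that picks the measurement to perform from the outcomes of the classical sources of $G$; every $G$ measurement is in the range of this function. A computation path $\mu$ assigns to each gate an outcome of the measurement selected by the outcomes that $\mu$ assigns to the gate's classical sources. The gates of a bout act in parallel (as a tensor product); $\mathrm{Out}_{\mathcal C}(\mu|\sigma)$ is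 the state after the last bout, and $P_{\mathcal C}(\mu|\sigma)$ is the product of the probabilities of the joint outcomes at the successive bouts. A measurement tree $\mathcal T$ over $\mathcal K$ is a rooted tree with a finite bound on the lengths of branches, where each non-leaf node carries a measurement over $\mathcal K$ and its outgoing edges are labeled one-to-one by the outcomes. For a branch $\beta=(o_1,\dots,o_N)$ with corresponding operators $A_1,\dots,A_N$ let $C_\beta=A_N\cdots A_1$ (so $C_\beta=\mathrm{Id}$ if $N=0$), and let $P_{\mathcal T}(\beta|\sigma)$ be the product of the probabilities of the successive outcomes. **Theorem.** Let $\dim\mathcal H\ge2$, let $a\in\mathcal A$ be a unit vector, and let $U:\mathcal H\to\mathcal H$ be an isometry, i.e. a bounded operator with $U^\dagger U=\mathrm{Id}$. Write $\bar\rho=\rho\otimes|a\rangle\langle a|$ for $\rho\in DO(\mathcal H)$. (1) Let $\mathcal C$ be a quantum circuit over $\mathcal H\otimes\mathcal A$ and $\mu$ a computation path such that, for every $\rho\in DO(\mathcal H)$, $\mathrm{Tr}_{\mathcal A}\,\mathrm{Out}_{\mathcal C}(\mu|\bar\rho)$ equals $U\rho U^\dagger$ up to a scalar factor (which may depend on $\rho$,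 and may be $0$). Then $P_{\mathcal C}(\mu|\bar\rho)$ does not depend on $\rho\in DO(\mathcal H)$. (2) Let $\mathcal T$ be a measurement tree over $\mathcal H\otimes\mathcal A$ and $\beta$ a branch such that, for every pure $\rho\in DO(\mathcal H)$, $\mathrm{Tr}_{\mathcal A}(C_\beta\bar\rho C_\beta^\dagger)$ equals $U\rho U^\dagger$ up to a scalar factor (which may depend on $\rho$, and may be $0$). Then there is $b\in\mathcal A$ such that for all $\rho\in DO(\mathcal H)$, pure or not, $C_\beta\bar\rho C_\beta^\dagger=U\rho U^\dagger\otimes|b\rangle\langle b|$ and $P_{\mathcal T}(\beta|\bar\rho)=\mathrm{Tr}(|b\rangle\langle b|)=\|b\|^2$. Moreover, if $P_{\mathcal T}(\beta|\bar\rho)>0$ for some $\rho\in DO(\mathcal H)$, then $P_{\mathcal T}(\beta|\bar\rho)>0$ for all $\rho\in DO(\mathcal H)$. -/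

import Mathlib

open scoped TensorProduct InnerProductSpace InnerProduct ENNReal

noncomputable section

namespace QIndep

set_option linter.unusedSectionVars false

/-! ### Trace and density operators -/

section Trace

variable {K : Type*} [NormedAddCommGroup K] [InnerProductSpace ℂ K] [CompleteSpace K]

/-- The index set of a Hilbert basis of `K`, fixed once and for all. -/
def basisSet (K : Type*) [NormedAddCommGroup K] [InnerProductSpace ℂ K] [CompleteSpace K] :
    Set K :=
  (exists_hilbertBasis ℂ K).choose

/-- A Hilbert basis of `K`, fixed once and for all. -/
def stdBasis (K : Type*) [NormedAddCommGroup K] [InnerProductSpace ℂ K] [CompleteSpace K] :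
    HilbertBasis (basisSet K) ℂ K :=
  (exists_hilbertBasis ℂ K).choose_spec.choose

/-- The trace `∑ ⟨e|T|e⟩ ∈ [0, ∞]` of a positive operator (it does not depend on the basis). -/
def etrace (T : K →L[ℂ] K) : ℝ≥0∞ :=
  ∑' i, ENNReal.ofReal (⟪stdBasis K i, T (stdBasis K i)⟫_ℂ).re

/-- The trace of a positive trace-class operator, as a real number. -/
def tr (T : K →L[ℂ] K) : ℝ := (etrace T).toReal

/-- Density operators, not necessarily normalized: nonzero, positive semidefinite Hermitian,
of finite trace. -/
structure IsDensity (ρ : K →L[ℂ] K) : Prop where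
  ne_zero : ρ ≠ 0
  pos : ρ.IsPositive
  trace_ne_top : etrace ρ ≠ ∞

/-- `|v⟩⟨v|` -/
def ketbra (v : K) : K →L[ℂ] K := InnerProductSpace.rankOne ℂ v v

/-- Pure (not necessarily normalized) density operators. -/
def IsPure (ρ : K →L[ℂ] K) : Prop := ∃ ψ : K, ψ ≠ 0 ∧ ρ = ketbra ψ

/-- Isometries: operators `L` with `L† L = Id`. -/
def IsIsom (L : K →L[ℂ] K) : Prop := ContinuousLinearMap.adjoint L * L = 1

/-- `L σ L†` -/
def conj {K' : Type*} [NormedAddCommGroup K'] [InnerProductSpace ℂ K'] [CompleteSpace K']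
    (L : K →L[ℂ] K') (σ : K →L[ℂ] K) : K' →L[ℂ] K' :=
  L ∘L σ ∘L ContinuousLinearMap.adjoint L

end Trace

/-! ### The Hilbert tensor product `H ⊗ A` and the partial trace over `A` -/

section Tensor

variable {H A : Type*} [NormedAddCommGroup H] [InnerProductSpace ℂ H] [CompleteSpace H]
  [NormedAddCommGroup A] [InnerProductSpace ℂ A] [CompleteSpace A]

/-- The tensor product of two Hilbert spaces: the completion of the algebraic one. -/
abbrev HTensor (H A : Type*) [NormedAddCommGroup H] [InnerProductSpace ℂ H]
    [NormedAddCommGroup A] [InnerProductSpace ℂ A] : Type _ :=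
  UniformSpace.Completion (H ⊗[ℂ] A)

/-- The operator `|ψ⟩ ↦ |ψ⟩ ⊗ |a⟩` from `H` to `H ⊗ A`. -/
def tensorKet (H : Type*) [NormedAddCommGroup H] [InnerProductSpace ℂ H] (a : A) :
    H →L[ℂ] HTensor H A :=
  UniformSpace.Completion.toComplL ∘L (TensorProduct.mkL ℂ H A).flip a

/-- The operator `ρ ⊗ |a⟩⟨a|` on `H ⊗ A`. -/
def tensorKetbra (ρ : H →L[ℂ] H) (a : A) : HTensor H A →L[ℂ] HTensor H A :=
  conj (tensorKet H a) ρ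

theorem tensorKet_apply (ψ : H) (a : A) :
    tensorKet H a ψ = ((ψ ⊗ₜ[ℂ] a : H ⊗[ℂ] A) : HTensor H A) := rfl

/-- `ρ ⊗ |a⟩⟨a|` maps `φ ⊗ c` to `ρ φ ⊗ ⟨a|c⟩ a`. -/
theorem tensorKetbra_apply (ρ : H →L[ℂ] H) (a c : A) (φ : H) :
    tensorKetbra ρ a (tensorKet H c φ) = tensorKet H (⟪a, c⟫_ℂ • a) (ρ φ) := by
  have h : ContinuousLinearMap.adjoint (tensorKet H a) (tensorKet H c φ) = ⟪a, c⟫_ℂ • φ := by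
    refine ext_inner_left ℂ fun x => ?_
    rw [ContinuousLinearMap.adjoint_inner_right, tensorKet_apply, tensorKet_apply,
      UniformSpace.Completion.inner_coe, TensorProduct.inner_tmul, inner_smul_right, mul_comm]
  simp only [tensorKetbra, conj, ContinuousLinearMap.comp_apply, h, map_smul]
  rw [tensorKet_apply, tensorKet_apply, TensorProduct.tmul_smul,
    UniformSpace.Completion.coe_smul]

/-- `S` is the partial trace `Tr_A T`: `⟨φ|S|ψ⟩ = ∑ ⟨φ ⊗ e|T|ψ ⊗ e⟩` with `e` ranging over
an orthonormal basis of `A`. -/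
def IsPartialTrace (T : HTensor H A →L[ℂ] HTensor H A) (S : H →L[ℂ] H) : Prop :=
  ∀ φ ψ : H, HasSum
    (fun j => ⟪tensorKet H (stdBasis A j) φ, T (tensorKet H (stdBasis A j) ψ)⟫_ℂ) ⟪φ, S ψ⟫_ℂ

end Tensor

/-! ### Measurements, and performing a sequence of measurement operators -/

section Measurement

variable {K : Type*} [NormedAddCommGroup K] [InnerProductSpace ℂ K] [CompleteSpace K]

/-- A measurement over `K`: countably many operators `L i` with `∑ (L i)† (L i) = Id` in the
weak operator topology. -/
structure Measurement (K : Type*) [NormedAddCommGroup K] [InnerProductSpace ℂ K]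
    [CompleteSpace K] where
  Outcome : Type
  countable : Countable Outcome
  op : Outcome → K →L[ℂ] K
  complete : HasSum
    (fun i => ContinuousLinearMapWOT.ofCLM (ContinuousLinearMap.adjoint (op i) * op i))
    (ContinuousLinearMapWOT.ofCLM (1 : K →L[ℂ] K))

/-- The composition `A_N ∘ ⋯ ∘ A_1` of a list `[A_1, …, A_N]`. -/
def cumulative : List (K →L[ℂ] K) → (K →L[ℂ] K)
  | [] => 1
  | L :: Ls => cumulative Ls * L

/-- The post-measurement state after measurement operators `[A_1, …, A_N]` have been realized,
one after the other, starting in state `σ`. -/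
def runState : List (K →L[ℂ] K) → (K →L[ℂ] K) → (K →L[ℂ] K)
  | [], σ => σ
  | L :: Ls, σ => runState Ls (conj L σ)

/-- The probability `p_1 ⋯ p_N` that the measurement operators `[A_1, …, A_N]` are realized,
one after the other, starting in state `σ`. -/
def runProb : List (K →L[ℂ] K) → (K →L[ℂ] K) → ℝ
  | [], _ => 1
  | L :: Ls, σ => tr (conj L σ) / tr σ * runProb Ls (conj L σ)

end Measurement

/-! ### Measurement trees -/

section Tree

/-- Measurement trees over `K` whose branches have length at most `n`. -/
inductive MeasTree (K : Type*) [NormedAddCommGroup K] [InnerProductSpace ℂ K]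
    [CompleteSpace K] : ℕ → Type _ where
  | leaf {n : ℕ} : MeasTree K n
  | node {n : ℕ} (M : Measurement K) (child : M.Outcome → MeasTree K n) : MeasTree K (n + 1)

variable {K : Type*} [NormedAddCommGroup K] [InnerProductSpace ℂ K] [CompleteSpace K]

namespace MeasTree

/-- Branches, as sequences of outcomes. -/
def Branch : {n : ℕ} → MeasTree K n → Type
  | _, leaf => Unit
  | _, node M child => Σ o : M.Outcome, Branch (child o)

/-- The list of the measurement operators along a branch. -/
def ops : {n : ℕ} → (T : MeasTree K n) → T.Branch → List (K →L[ℂ] K)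
  | _, leaf, _ => []
  | _, node M child, b => M.op b.1 :: ops (child b.1) b.2

/-- The cumulative operator `C_β`. -/
def cumOp {n : ℕ} (T : MeasTree K n) (β : T.Branch) : K →L[ℂ] K := cumulative (T.ops β)

/-- `P_T(β | σ)` -/
def prob {n : ℕ} (T : MeasTree K n) (β : T.Branch) (σ : K →L[ℂ] K) : ℝ := runProb (T.ops β) σ

/-- `T`, with ancilla vector `a`, computes `U` on principal input `ρ` along branch `β`:
`Tr_A (C_β (ρ ⊗ |a⟩⟨a|) C_β†)` agrees with `U ρ U†` up to a scalar factor.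
The factor may be zero, namely when `β` is not attainable on `ρ`. -/
def Computes {H A : Type*} [NormedAddCommGroup H] [InnerProductSpace ℂ H] [CompleteSpace H]
    [NormedAddCommGroup A] [InnerProductSpace ℂ A] [CompleteSpace A] {n : ℕ}
    (T : MeasTree (HTensor H A) n) (β : T.Branch) (a : A) (U ρ : H →L[ℂ] H) : Prop :=
  ∃ c : ℂ, IsPartialTrace (conj (T.cumOp β) (tensorKetbra ρ a)) (c • conj U ρ)

end MeasTree

end Tree

/-! ### Operators acting on some of the tensor factors

A Hilbert space with a Hilbert basis indexed by `ι` is `L2 ι`; the tensor product of the spaces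
`L2 (ι q)` over finitely many `q` is `L2 (∀ q, ι q)`. -/

section Local

/-- `ℓ²(ι)` over `ℂ` -/
abbrev L2 (ι : Type) : Type := lp (fun _ : ι => ℂ) 2

theorem L2.summable {ι : Type} (f : L2 ι) : Summable fun i => ‖f i‖ ^ 2 := by
  simpa using (lp.memℓp f).summable (by norm_num)

theorem L2.norm_sq {ι : Type} (f : L2 ι) : ‖f‖ ^ 2 = ∑' i, ‖f i‖ ^ 2 := by
  simpa using lp.norm_rpow_eq_tsum (p := 2) (by norm_num) f

theorem L2.memℓp {ι : Type} {f : ι → ℂ} (h : Summable fun i => ‖f i‖ ^ 2) :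
    Memℓp (E := fun _ : ι => ℂ) f 2 := by
  refine memℓp_gen ?_
  simpa using h

variable {X I J : Type}

theorem L2.summable_slice (e : X ≃ I × J) (f : L2 X) (j : J) :
    Summable fun i => ‖f (e.symm (i, j))‖ ^ 2 :=
  (L2.summable f).comp_injective (i := fun i => e.symm (i, j)) fun i i' h => by simpa using h

/-- The slice `i ↦ f (i, j)` of a vector `f` of `ℓ²(X) = ℓ²(I × J)`. -/
def slice (e : X ≃ I × J) (f : L2 X) (j : J) : L2 I :=
  ⟨fun i => f (e.symm (i, j)), L2.memℓp (L2.summable_slice e f j)⟩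

theorem slice_add (e : X ≃ I × J) (f g : L2 X) (j : J) :
    slice e (f + g) j = slice e f j + slice e g j := rfl

theorem slice_smul (e : X ≃ I × J) (c : ℂ) (f : L2 X) (j : J) :
    slice e (c • f) j = c • slice e f j := rfl

theorem hasSum_norm_slice (e : X ≃ I × J) (f : L2 X) :
    HasSum (fun j => ‖slice e f j‖ ^ 2) (‖f‖ ^ 2) := by
  have h : HasSum (fun x => ‖f x‖ ^ 2) (‖f‖ ^ 2) := by
    rw [L2.norm_sq]; exact (L2.summable f).hasSum
  have h' : HasSum (fun p : J × I => ‖f (e.symm (p.2, p.1))‖ ^ 2) (‖f‖ ^ 2) :=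
    (((Equiv.prodComm J I).trans e.symm).hasSum_iff (f := fun x => ‖f x‖ ^ 2)).2 h
  refine h'.prod_fiberwise fun j => ?_
  rw [L2.norm_sq]
  exact (L2.summable_slice e f j).hasSum

theorem hasSum_fibers (e : X ≃ I × J) (F : J → L2 I) {s : ℝ}
    (h : HasSum (fun j => ‖F j‖ ^ 2) s) : HasSum (fun x => ‖F (e x).2 (e x).1‖ ^ 2) s := by
  have hF : ∀ j, HasSum (fun i => ‖F j i‖ ^ 2) (‖F j‖ ^ 2) := fun j => by
    rw [L2.norm_sq]; exact (L2.summable (F j)).hasSum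
  obtain ⟨G, hG⟩ : ∃ G : J × I → ℝ, ∀ p, G p = ‖F p.1 p.2‖ ^ 2 := ⟨_, fun _ => rfl⟩
  have hF' : ∀ j, HasSum (fun i => G (j, i)) (‖F j‖ ^ 2) := fun j => by
    simpa only [hG] using hF j
  have hp : Summable G := by
    rw [summable_prod_of_nonneg fun p => by rw [hG]; exact sq_nonneg _]
    refine ⟨fun j => (hF' j).summable, h.summable.congr fun j => (hF' j).tsum_eq.symm⟩
  have hs : ∑' p, G p = s := (hp.hasSum.prod_fiberwise hF').unique h
  have := ((e.trans (Equiv.prodComm I J)).hasSum_iff (f := G)).2 (hs ▸ hp.hasSum)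
  refine Eq.mp (congrArg (fun u => HasSum u s) (funext fun x => ?_)) this
  exact hG _

theorem hasSum_ampl (e : X ≃ I × J) (L : L2 I →L[ℂ] L2 I) (f : L2 X) :
    ∃ s ≤ (‖L‖ * ‖f‖) ^ 2, HasSum (fun x => ‖L (slice e f (e x).2) (e x).1‖ ^ 2) s := by
  have hle : ∀ j, ‖L (slice e f j)‖ ^ 2 ≤ ‖L‖ ^ 2 * ‖slice e f j‖ ^ 2 := fun j => by
    rw [← mul_pow]
    exact pow_le_pow_left₀ (norm_nonneg _) (L.le_opNorm _) 2
  have hs := (hasSum_norm_slice e f).mul_left (‖L‖ ^ 2)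
  have hsum : Summable fun j => ‖L (slice e f j)‖ ^ 2 :=
    hs.summable.of_nonneg_of_le (fun _ => by positivity) hle
  refine ⟨_, ?_, hasSum_fibers e (fun j => L (slice e f j)) hsum.hasSum⟩
  rw [mul_pow]
  exact hasSum_le hle hsum.hasSum hs

/-- The operator `L ⊗ Id` on `ℓ²(X) = ℓ²(I) ⊗ ℓ²(J)`, where `X` is identified with `I × J`. -/
def ampl (e : X ≃ I × J) (L : L2 I →L[ℂ] L2 I) : L2 X →L[ℂ] L2 X :=
  LinearMap.mkContinuous
    { toFun := fun f => ⟨fun x => L (slice e f (e x).2) (e x).1,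
        L2.memℓp (hasSum_ampl e L f).choose_spec.2.summable⟩
      map_add' := fun f g => by
        ext x; simp only [slice_add, map_add]; rfl
      map_smul' := fun c f => by
        ext x; simp only [slice_smul, map_smul]; rfl }
    ‖L‖ fun f => by
      obtain ⟨s, hs, h⟩ := hasSum_ampl e L f
      refine (sq_le_sq₀ (norm_nonneg _) (by positivity)).1 ?_
      rw [L2.norm_sq]
      exact h.tsum_eq.trans_le hs

theorem ampl_apply (e : X ≃ I × J) (L : L2 I →L[ℂ] L2 I) (f : L2 X) (x : X) :
    ampl e L f x = L (slice e f (e x).2) (e x).1 := rfl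

end Local

/-! ### Quantum circuits -/

/-- The wiring of a quantum circuit with `w` wires (carrying quantum registers) and `g` gates,
together with its execution schedule. -/
structure Wiring (w g : ℕ) where
  /-- labels of an orthonormal basis of the Hilbert space of each register -/
  ι : Fin w → Type
  countable : ∀ q, Countable (ι q)
  /-- the gates that a wire passes through, in this order -/
  wire : Fin w → List (Fin g)
  /-- the classical sources of a gate -/
  cs : Fin g → Finset (Fin g)
  /-- the number of bouts of the schedule -/
  N : ℕ
  /-- the number of the bout that a gate belongs to -/
  bout : Fin g → Fin N
  /-- quantum prerequisites are scheduled earlier -/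
  wire_bout : ∀ q, (wire q).Pairwise fun F G => bout F < bout G
  /-- classical prerequisites are scheduled earlier -/
  cs_bout : ∀ G, ∀ F ∈ cs G, bout F < bout G

namespace Wiring

variable {w g : ℕ} (S : Wiring w g)

/-- The tensor product of the Hilbert spaces of all registers. -/
abbrev FullSpace : Type := L2 (∀ q, S.ι q)

/-- The tensor product of the Hilbert spaces of the registers on which the gate `G` acts. -/
abbrev GateSpace (G : Fin g) : Type := L2 (∀ q : {q // G ∈ S.wire q}, S.ι q)

/-- `L ⊗ Id`, for an operator `L` on the registers of `G` and the identity on all others. -/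
def extend (G : Fin g) (L : S.GateSpace G →L[ℂ] S.GateSpace G) :
    S.FullSpace →L[ℂ] S.FullSpace :=
  ampl (Equiv.piEquivPiSubtypeProd (fun q => G ∈ S.wire q) S.ι) L

end Wiring

/-- A quantum circuit with full inputs and outputs in `K`. -/
structure QCircuit (K : Type*) [NormedAddCommGroup K] [InnerProductSpace ℂ K]
    [CompleteSpace K] where
  w : ℕ
  g : ℕ
  S : Wiring w g
  /-- how `K` is laid out on the wires at the beginning of the computation -/
  input : K ≃ₗᵢ[ℂ] S.FullSpace
  /-- how `K` is laid out on the wires at the end of the computation -/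
  output : K ≃ₗᵢ[ℂ] S.FullSpace
  /-- the names of the measurements assigned to a gate -/
  Meas : Fin g → Type
  meas_finite : ∀ G, Finite (Meas G)
  meas_nonempty : ∀ G, Nonempty (Meas G)
  /-- the measurements assigned to a gate -/
  meas : ∀ G, Meas G → Measurement (S.GateSpace G)
  /-- the selection functions; an outcome of a gate is an outcome of one of its measurements,
  and outcomes of different measurements are different -/
  select : ∀ G, (∀ F : {F // F ∈ S.cs G}, Σ m : Meas F, (meas F m).Outcome) → Meas G
  /-- there are no superfluous measurements -/
  select_surjective : ∀ G, Function.Surjective (select G)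

namespace QCircuit

variable {K : Type*} [NormedAddCommGroup K] [InnerProductSpace ℂ K] [CompleteSpace K]
  (C : QCircuit K)

/-- The outcomes of the measurements assigned to a gate. -/
abbrev Outcome (G : Fin C.g) : Type := Σ m : C.Meas G, (C.meas G m).Outcome

/-- Computation paths: each gate `G` gets an outcome of the measurement that the selection
function picks given the outcomes of the classical sources of `G`. -/
structure Path where
  out : ∀ G, C.Outcome G
  coherent : ∀ G, (out G).1 = C.select G fun F => out F

variable {C}

/-- The operator of the measurement at gate `G` that produces the outcome prescribed by `μ`,
acting on all registers. -/
def Path.gateOp (μ : C.Path) (G : Fin C.g) : C.S.FullSpace →L[ℂ] C.S.FullSpace :=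
  C.S.extend G ((C.meas G (μ.out G).1).op (μ.out G).2)

/-- The tensor product of the operators of the gates in the `n`-th bout. These gates act on
disjoint sets of registers, so it is the product, in any order, of the operators extended to
all registers. -/
def Path.boutOp (μ : C.Path) (n : Fin C.S.N) : C.S.FullSpace →L[ℂ] C.S.FullSpace :=
  (((List.finRange C.g).filter fun G => C.S.bout G = n).map μ.gateOp).prod

/-- The operators realized, bout after bout, along `μ`. -/
def Path.ops (μ : C.Path) : List (C.S.FullSpace →L[ℂ] C.S.FullSpace) :=
  (List.finRange C.S.N).map μ.boutOp

variable (C)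

/-- The initial state of the registers on full input `σ`. -/
def initial (σ : K →L[ℂ] K) : C.S.FullSpace →L[ℂ] C.S.FullSpace :=
  conj (C.input : K →L[ℂ] C.S.FullSpace) σ

/-- `Out_C(μ | σ)` -/
def outState (μ : C.Path) (σ : K →L[ℂ] K) : K →L[ℂ] K :=
  conj (C.output.symm : C.S.FullSpace →L[ℂ] K) (runState μ.ops (C.initial σ))

/-- `P_C(μ | σ)` -/
def prob (μ : C.Path) (σ : K →L[ℂ] K) : ℝ := runProb μ.ops (C.initial σ)

/-- `C`, with ancilla vector `a`, computes `U` on principal input `ρ` along the path `μ`: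
`Tr_A (Out_C(μ | ρ ⊗ |a⟩⟨a|))` agrees with `U ρ U†` up to a scalar factor.
The factor may be zero, namely when `μ` has probability zero on `ρ`. -/
def Computes {H A : Type*} [NormedAddCommGroup H] [InnerProductSpace ℂ H] [CompleteSpace H]
    [NormedAddCommGroup A] [InnerProductSpace ℂ A] [CompleteSpace A]
    (C : QCircuit (HTensor H A)) (μ : C.Path) (a : A) (U ρ : H →L[ℂ] H) : Prop :=
  ∃ c : ℂ, IsPartialTrace (C.outState μ (tensorKetbra ρ a)) (c • conj U ρ)

end QCircuit

end QIndep

end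

open scoped TensorProduct InnerProductSpace InnerProduct ENNReal

namespace QIndep

set_option linter.unusedSectionVars false

/-! ### Traces of positive operators as squared Hilbert-Schmidt norms. -/

section HilbertSchmidt

variable {K K' K'' : Type*} [NormedAddCommGroup K] [InnerProductSpace ℂ K] [CompleteSpace K]
  [NormedAddCommGroup K'] [InnerProductSpace ℂ K'] [CompleteSpace K']
  [NormedAddCommGroup K''] [InnerProductSpace ℂ K''] [CompleteSpace K'']

/-! A computation path or a branch acts on states as `σ ↦ W σ W†` for a single bounded operator `W`,
and its stepwise probabilities telescope to `Tr(W σ W†) / Tr σ` (`runProb_eq`). Circuits and trees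
therefore reduce to one question about `V ψ = W (ψ ⊗ a)`.

For `ρ = |ψ⟩⟨ψ|` the hypothesis says that the partial trace of `|V ψ⟩⟨V ψ|` is proportional to `|U
ψ⟩⟨U ψ|`. A reduced state of rank at most one forces a product vector, so `V ψ = U ψ ⊗ b` with `b`
possibly depending on `ψ` (`IsPartialTrace.exists_eq_tensorKet`). Linearity of `V`, tested on `ψ₀`,
`ψ` and `ψ₀ + ψ` with `ψ ⊥ ψ₀`, makes `b` constant (`exists_eq_tensorKet_comp`).

Hence `V` multiplies all norms by `‖b‖`. Conjugation by such an operator multiplies the trace of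
every positive operator, pure or mixed, by `‖b‖ ^ 2` (`etrace_conj_eq_mul`), and this factor is the
probability. -/

theorem tsum_enorm_inner_sq {ι : Type*} (b : HilbertBasis ι ℂ K) (x : K) :
    ∑' i, ‖⟪x, b i⟫_ℂ‖ₑ ^ 2 = ‖x‖ₑ ^ 2 := by
  have h := b.hasSum_inner_mul_inner x x
  have h' : HasSum (fun i => ‖⟪x, b i⟫_ℂ‖ ^ 2) (‖x‖ ^ 2) := by
    have e : ∀ i, ⟪x, b i⟫_ℂ * ⟪b i, x⟫_ℂ = ((‖⟪x, b i⟫_ℂ‖ ^ 2 : ℝ) : ℂ) := fun i => by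
      rw [← inner_conj_symm (b i) x, RCLike.mul_conj]
      norm_cast
    have e' : ⟪x, x⟫_ℂ = ((‖x‖ ^ 2 : ℝ) : ℂ) := by
      rw [inner_self_eq_norm_sq_to_K]
      norm_cast
    simp_rw [e, e'] at h
    exact Complex.hasSum_ofReal.1 h
  have e := ENNReal.ofReal_tsum_of_nonneg (fun i => sq_nonneg ‖⟪x, b i⟫_ℂ‖) h'.summable
  rw [h'.tsum_eq] at e
  simpa [ENNReal.ofReal_pow, ofReal_norm] using e.symm

/-- The Hilbert-Schmidt norm of an operator equals that of its adjoint. -/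
theorem tsum_enorm_adjoint_sq {ι ι' : Type*} (b : HilbertBasis ι ℂ K) (b' : HilbertBasis ι' ℂ K')
    (B : K →L[ℂ] K') :
    ∑' j, ‖ContinuousLinearMap.adjoint B (b' j)‖ₑ ^ 2 = ∑' i, ‖B (b i)‖ₑ ^ 2 := by
  simp_rw [← tsum_enorm_inner_sq b', ← tsum_enorm_inner_sq b]
  rw [ENNReal.tsum_comm]
  refine tsum_congr fun i => tsum_congr fun j => ?_
  rw [ContinuousLinearMap.adjoint_inner_left, ← enorm_norm, norm_inner_symm, enorm_norm]

theorem etrace_adjoint_comp (B : K →L[ℂ] K') :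
    etrace (ContinuousLinearMap.adjoint B ∘L B) = ∑' i, ‖B (stdBasis K i)‖ₑ ^ 2 := by
  refine tsum_congr fun i => ?_
  rw [ContinuousLinearMap.comp_apply, ContinuousLinearMap.adjoint_inner_right,
    inner_self_eq_norm_sq_to_K]
  norm_cast
  change ENNReal.ofReal (‖_‖ ^ 2) = _
  rw [ENNReal.ofReal_pow (norm_nonneg _), ofReal_norm]

/-- The trace is the squared Hilbert-Schmidt norm of `S L†`, hence also of its adjoint `L S†`. With
`L` applied last, pointwise norm estimates for `L` become trace estimates. -/
theorem etrace_conj_adjoint_comp (L : K →L[ℂ] K') (S : K →L[ℂ] K) :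
    etrace (conj L (ContinuousLinearMap.adjoint S ∘L S)) =
      ∑' i, ‖L (ContinuousLinearMap.adjoint S (stdBasis K i))‖ₑ ^ 2 := by
  have h : conj L (ContinuousLinearMap.adjoint S ∘L S) = ContinuousLinearMap.adjoint
      (S ∘L ContinuousLinearMap.adjoint L) ∘L (S ∘L ContinuousLinearMap.adjoint L) := by
    rw [ContinuousLinearMap.adjoint_comp, ContinuousLinearMap.adjoint_adjoint]
    rfl
  rw [h, etrace_adjoint_comp, ← tsum_enorm_adjoint_sq _ (stdBasis K),
    ContinuousLinearMap.adjoint_comp, ContinuousLinearMap.adjoint_adjoint]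
  rfl

theorem exists_eq_adjoint_comp {σ : K →L[ℂ] K} (hσ : σ.IsPositive) :
    ∃ S : K →L[ℂ] K, σ = ContinuousLinearMap.adjoint S ∘L S := by
  obtain ⟨S, hS⟩ := CStarAlgebra.nonneg_iff_eq_star_mul_self.1
    ((ContinuousLinearMap.nonneg_iff_isPositive σ).2 hσ)
  exact ⟨S, hS⟩

theorem conj_conj (L' : K' →L[ℂ] K'') (L : K →L[ℂ] K') (σ : K →L[ℂ] K) :
    conj L' (conj L σ) = conj (L' ∘L L) σ := by
  simp only [conj, ContinuousLinearMap.adjoint_comp, ContinuousLinearMap.comp_assoc]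

theorem conj_one (σ : K →L[ℂ] K) : conj 1 σ = σ := by
  rw [conj, ← ContinuousLinearMap.star_eq_adjoint, star_one]
  rfl

theorem conj_zero (L : K →L[ℂ] K') : conj L (0 : K →L[ℂ] K) = 0 := by
  simp [conj]

theorem conj_ketbra (L : K →L[ℂ] K') (v : K) : conj L (ketbra v) = ketbra (L v) := by
  simp only [conj, ketbra, InnerProductSpace.comp_rankOne, InnerProductSpace.rankOne_comp,
    ContinuousLinearMap.adjoint_adjoint]

/-- Keeps the intermediate states of a run trace-class. -/
theorem etrace_conj_le (L : K →L[ℂ] K') {σ : K →L[ℂ] K} (hσ : σ.IsPositive) :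
    etrace (conj L σ) ≤ ‖L‖ₑ ^ 2 * etrace σ := by
  obtain ⟨S, rfl⟩ := exists_eq_adjoint_comp hσ
  rw [etrace_conj_adjoint_comp, etrace_adjoint_comp, ← tsum_enorm_adjoint_sq _ (stdBasis K),
    ← ENNReal.tsum_mul_left]
  refine ENNReal.tsum_le_tsum fun i => ?_
  rw [← mul_pow]
  exact pow_le_pow_left' (L.le_opENorm _) 2

/-- Used with `c = 1` for the layouts of a circuit on its wires, and with `c = ‖b‖` for `ψ ↦ U ψ ⊗
b`. -/
theorem etrace_conj_eq_mul {L : K →L[ℂ] K'} {c : ℝ≥0∞} (hL : ∀ x, ‖L x‖ₑ = c * ‖x‖ₑ)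
    {σ : K →L[ℂ] K} (hσ : σ.IsPositive) : etrace (conj L σ) = c ^ 2 * etrace σ := by
  obtain ⟨S, rfl⟩ := exists_eq_adjoint_comp hσ
  simp_rw [etrace_conj_adjoint_comp, etrace_adjoint_comp,
    ← tsum_enorm_adjoint_sq (stdBasis K) (stdBasis K) S, ← ENNReal.tsum_mul_left, hL, mul_pow]

theorem eq_zero_of_etrace_eq_zero {σ : K →L[ℂ] K} (hσ : σ.IsPositive) (h : etrace σ = 0) :
    σ = 0 := by
  obtain ⟨S, rfl⟩ := exists_eq_adjoint_comp hσ
  rw [etrace_adjoint_comp, ENNReal.tsum_eq_zero] at h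
  -- The coordinates of `S† x` are inner products of `x` with the vectors `S eᵢ`, all of which
  -- vanish; Parseval concludes.
  have hS : ContinuousLinearMap.adjoint S = 0 := by
    ext x
    have := tsum_enorm_inner_sq (stdBasis K) (ContinuousLinearMap.adjoint S x)
    simp_rw [ContinuousLinearMap.adjoint_inner_left] at this
    have h0 : ∀ i, S (stdBasis K i) = 0 := fun i => by simpa using h i
    simpa [h0] using this.symm
  rw [hS, ContinuousLinearMap.zero_comp]

theorem etrace_ketbra (v : K) : etrace (ketbra v) = ‖v‖ₑ ^ 2 := by
  rw [← tsum_enorm_inner_sq (stdBasis K) v]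
  refine tsum_congr fun i => ?_
  rw [ketbra, InnerProductSpace.rankOne_apply, inner_smul_right,
    ← inner_conj_symm (stdBasis K i) v, RCLike.mul_conj]
  norm_cast
  change ENNReal.ofReal (‖_‖ ^ 2) = _
  rw [ENNReal.ofReal_pow (norm_nonneg _), ofReal_norm]

theorem tr_ketbra (v : K) : tr (ketbra v) = ‖v‖ ^ 2 := by
  simp [tr, etrace_ketbra]

theorem IsPure.isDensity {ρ : K →L[ℂ] K} (h : IsPure ρ) : IsDensity ρ := by
  obtain ⟨ψ, hψ, rfl⟩ := h
  refine ⟨InnerProductSpace.rankOne_ne_zero hψ hψ, InnerProductSpace.isPositive_rankOne_self ψ, ?_⟩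
  rw [etrace_ketbra]
  finiteness

theorem IsDensity.tr_pos {ρ : K →L[ℂ] K} (h : IsDensity ρ) : 0 < tr ρ :=
  ENNReal.toReal_pos (fun h0 => h.ne_zero (eq_zero_of_etrace_eq_zero h.pos h0)) h.trace_ne_top

theorem IsDensity.conj_of_enorm {ρ : K →L[ℂ] K} (h : IsDensity ρ) {L : K →L[ℂ] K'}
    (hL : ∀ x, ‖L x‖ₑ = ‖x‖ₑ) : IsDensity (conj L ρ) := by
  have e : etrace (conj L ρ) = etrace ρ := by
    simpa using etrace_conj_eq_mul (c := 1) (fun x => by rw [hL, one_mul]) h.pos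
  refine ⟨fun h0 => ?_, h.pos.conj_adjoint L, e ▸ h.trace_ne_top⟩
  refine h.ne_zero (eq_zero_of_etrace_eq_zero h.pos ?_)
  rw [← e, h0]
  simp [etrace]

end HilbertSchmidt

/-! ### Collapsing a sequence of measurement operators into one. -/

section Run

variable {K : Type*} [NormedAddCommGroup K] [InnerProductSpace ℂ K] [CompleteSpace K]

theorem runState_eq_conj (Ls : List (K →L[ℂ] K)) (σ : K →L[ℂ] K) :
    runState Ls σ = conj (cumulative Ls) σ := by
  induction Ls generalizing σ with
  | nil => exact (conj_one σ).symm
  | cons L Ls ih => rw [runState, ih, conj_conj]; rfl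

/-- The probabilities along a run telescope. -/
theorem runProb_eq (Ls : List (K →L[ℂ] K)) {σ : K →L[ℂ] K} (hσ : IsDensity σ) :
    runProb Ls σ = tr (conj (cumulative Ls) σ) / tr σ := by
  induction Ls generalizing σ with
  | nil => rw [runProb, cumulative, conj_one, div_self hσ.tr_pos.ne']
  | cons L Ls ih =>
    have hc : conj (cumulative (L :: Ls)) σ = conj (cumulative Ls) (conj L σ) :=
      (conj_conj _ _ _).symm
    rw [runProb, hc]
    -- If the first outcome is unattainable, its factor is `0`, so the later factors, quotients by
    -- the trace of a zero state, do not matter.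
    by_cases h0 : conj L σ = 0
    · rw [h0, conj_zero]
      simp [tr, etrace]
    · have hL : IsDensity (conj L σ) := by
        refine ⟨h0, hσ.pos.conj_adjoint L, ne_top_of_le_ne_top ?_ (etrace_conj_le L hσ.pos)⟩
        exact ENNReal.mul_ne_top (by finiteness) hσ.trace_ne_top
      rw [ih hL]
      have := hL.tr_pos.ne'
      field_simp

end Run

/-! ### Product vectors and partial traces. -/

section Tensor

variable {H A : Type*} [NormedAddCommGroup H] [InnerProductSpace ℂ H] [CompleteSpace H]
  [NormedAddCommGroup A] [InnerProductSpace ℂ A] [CompleteSpace A]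

theorem inner_tensorKet (φ ψ : H) (b c : A) :
    ⟪tensorKet H b φ, tensorKet H c ψ⟫_ℂ = ⟪φ, ψ⟫_ℂ * ⟪b, c⟫_ℂ := by
  rw [tensorKet_apply, tensorKet_apply, UniformSpace.Completion.inner_coe,
    TensorProduct.inner_tmul]

theorem enorm_tensorKet (b : A) (ψ : H) : ‖tensorKet H b ψ‖ₑ = ‖b‖ₑ * ‖ψ‖ₑ := by
  rw [tensorKet_apply, ← ofReal_norm, UniformSpace.Completion.norm_coe, ofReal_norm,
    TensorProduct.enorm_tmul, mul_comm]

/-- The operator `|c⟩ ↦ |φ⟩ ⊗ |c⟩` from `A` to `H ⊗ A`. -/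
noncomputable def ketTensor (A : Type*) [NormedAddCommGroup A] [InnerProductSpace ℂ A] (φ : H) :
    A →L[ℂ] HTensor H A :=
  UniformSpace.Completion.toComplL ∘L TensorProduct.mkL ℂ H A φ

theorem ketTensor_apply (φ : H) (c : A) : ketTensor A φ c = tensorKet H c φ := rfl

/-- Vectors of `H ⊗ A` are separated by their inner products with product vectors. -/
theorem ext_inner_tensorKet {v v' : HTensor H A}
    (h : ∀ (φ : H) (c : A), ⟪tensorKet H c φ, v⟫_ℂ = ⟪tensorKet H c φ, v'⟫_ℂ) : v = v' := by
  refine ext_inner_left ℂ fun x => ?_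
  induction x using UniformSpace.Completion.induction_on with
  | hp => exact
    isClosed_eq (continuous_id.inner continuous_const) (continuous_id.inner continuous_const)
  | ih x =>
    induction x using TensorProduct.induction_on with
    | zero => simp only [UniformSpace.Completion.coe_zero, inner_zero_left]
    | tmul φ c => exact h φ c
    | add x y hx hy => simp only [UniformSpace.Completion.coe_add, inner_add_left, hx, hy]

/-- If the partial trace of `|v⟩⟨v|` is proportional to `|u⟩⟨u|` then `v = u ⊗ b`. -/
theorem IsPartialTrace.exists_eq_tensorKet {v : HTensor H A} {u : H} (hu : u ≠ 0) {c : ℂ}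
    (h : IsPartialTrace (ketbra v) (c • ketbra u)) : ∃ b : A, v = tensorKet H b u := by
  -- The adjoint of `ketTensor A φ` takes the partial inner product with `φ`, a vector of `A`. Its
  -- squared norm is the diagonal entry at `φ` of the partial trace of `|v⟩⟨v|`, which is zero when
  -- `φ ⊥ u`.
  have horth : ∀ φ : H, ⟪φ, u⟫_ℂ = 0 → ContinuousLinearMap.adjoint (ketTensor A φ) v = 0 := by
    intro φ hφ
    have hs := h φ φ
    have hz : ⟪φ, (c • ketbra u) φ⟫_ℂ = 0 := by
      simp [ketbra, hφ]
    rw [hz] at hs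
    have e : ∀ j, ⟪tensorKet H (stdBasis A j) φ, ketbra v (tensorKet H (stdBasis A j) φ)⟫_ℂ
        = ((‖⟪ContinuousLinearMap.adjoint (ketTensor A φ) v, stdBasis A j⟫_ℂ‖ ^ 2 : ℝ) : ℂ) := by
      intro j
      rw [ContinuousLinearMap.adjoint_inner_left, ketTensor_apply, ketbra,
        InnerProductSpace.rankOne_apply, inner_smul_right,
        ← inner_conj_symm (tensorKet H (stdBasis A j) φ) v, RCLike.mul_conj]
      norm_cast
    simp_rw [e] at hs
    have hs' := (hasSum_zero_iff_of_nonneg fun j => sq_nonneg _).1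
      (Complex.hasSum_ofReal.1 (by simpa only [Complex.ofReal_zero] using hs))
    have h0 := tsum_enorm_inner_sq (stdBasis A) (ContinuousLinearMap.adjoint (ketTensor A φ) v)
    have h1 : ∀ j, ⟪ContinuousLinearMap.adjoint (ketTensor A φ) v, stdBasis A j⟫_ℂ = 0 :=
      fun j => by simpa using congrFun hs' j
    simpa [h1] using h0.symm
  have hn : ⟪u, u⟫_ℂ ≠ 0 := inner_self_ne_zero.2 hu
  -- By `horth` only the component of `φ` along `u` contributes to the partial inner product of `φ`
  -- with `v`; so `b` is the partial inner product with `u`, normalized.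
  refine ⟨(⟪u, u⟫_ℂ)⁻¹ • ContinuousLinearMap.adjoint (ketTensor A u) v,
    ext_inner_tensorKet fun φ c' => ?_⟩
  have hd : ⟪φ - (⟪u, φ⟫_ℂ / ⟪u, u⟫_ℂ) • u, u⟫_ℂ = 0 := by
    rw [inner_sub_left, inner_smul_left, map_div₀, inner_conj_symm, inner_conj_symm,
      div_mul_cancel₀ _ hn, sub_self]
  have h1 := congrArg (inner ℂ c') (horth _ hd)
  rw [ContinuousLinearMap.adjoint_inner_right, ketTensor_apply, map_sub, map_smul, inner_sub_left,
    inner_smul_left, inner_zero_right, sub_eq_zero, map_div₀, inner_conj_symm, inner_conj_symm]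
    at h1
  rw [h1, inner_tensorKet, inner_smul_right, ContinuousLinearMap.adjoint_inner_right,
    ketTensor_apply]
  field_simp

/-- A linear map that sends every `ψ` to a product vector `U ψ ⊗ b`, with `b` possibly depending
on `ψ`, is of the form `ψ ↦ U ψ ⊗ b` with `b` fixed. -/
theorem exists_eq_tensorKet_comp {V : H →L[ℂ] HTensor H A} {U : H →L[ℂ] H}
    (hU : ∀ x y, ⟪U x, U y⟫_ℂ = ⟪x, y⟫_ℂ)
    (hV : ∀ ψ, ψ ≠ 0 → ∃ b : A, V ψ = tensorKet H b (U ψ)) :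
    ∃ b : A, V = tensorKet H b ∘L U := by
  by_cases hn : ∃ ψ₀ : H, ψ₀ ≠ 0
  swap
  · push Not at hn
    exact ⟨0, by ext ψ; simp [hn ψ]⟩
  obtain ⟨ψ₀, h₀⟩ := hn
  obtain ⟨b, hb⟩ := hV ψ₀ h₀
  have key : ∀ ψ, ⟪ψ₀, ψ⟫_ℂ = 0 → V ψ = tensorKet H b (U ψ) := by
    intro ψ horth
    by_cases hψ : ψ = 0
    · simp [hψ]
    have horth' : ⟪ψ, ψ₀⟫_ℂ = 0 := inner_eq_zero_symm.1 horth
    have hs : ψ₀ + ψ ≠ 0 := fun h => by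
      have := congrArg (inner ℂ ψ) h
      rw [inner_add_right, horth', zero_add, inner_zero_right] at this
      exact hψ (inner_self_eq_zero.1 this)
    obtain ⟨b₁, hb₁⟩ := hV ψ hψ
    obtain ⟨b₂, hb₂⟩ := hV _ hs
    rw [map_add, map_add, map_add, hb, hb₁] at hb₂
    -- Pair `V ψ₀ + V ψ = V (ψ₀ + ψ)` with `U φ ⊗ c`; `U` drops out because it preserves inner
    -- products. Since `ψ ⊥ ψ₀`, the choices `φ = ψ₀` and `φ = ψ` isolate `b = b₂` and `b₁ = b₂`.
    have e : ∀ (φ : H) (c : A), ⟪φ, ψ₀⟫_ℂ * ⟪c, b⟫_ℂ + ⟪φ, ψ⟫_ℂ * ⟪c, b₁⟫_ℂ =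
        ⟪φ, ψ₀⟫_ℂ * ⟪c, b₂⟫_ℂ + ⟪φ, ψ⟫_ℂ * ⟪c, b₂⟫_ℂ := fun φ c => by
      simpa only [inner_add_right, inner_tensorKet, hU] using
        congrArg (inner ℂ (tensorKet H c (U φ))) hb₂
    have e₀ : b = b₂ := ext_inner_left ℂ fun c => by
      have := e ψ₀ c
      rw [horth, zero_mul, zero_mul, add_zero, add_zero] at this
      exact mul_left_cancel₀ (inner_self_ne_zero.2 h₀) this
    have e₁ : b₁ = b₂ := ext_inner_left ℂ fun c => by
      have := e ψ c
      rw [horth', zero_mul, zero_mul, zero_add, zero_add] at this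
      exact mul_left_cancel₀ (inner_self_ne_zero.2 hψ) this
    rw [hb₁, e₁, e₀]
  refine ⟨b, ContinuousLinearMap.ext fun ψ => ?_⟩
  -- A general `ψ` is a multiple of `ψ₀` plus a vector orthogonal to it; the formula holds for both.
  have hd : ⟪ψ₀, ψ - (⟪ψ₀, ψ⟫_ℂ / ⟪ψ₀, ψ₀⟫_ℂ) • ψ₀⟫_ℂ = 0 := by
    rw [inner_sub_right, inner_smul_right, div_mul_cancel₀ _ (inner_self_ne_zero.2 h₀), sub_self]
  have := key _ hd
  simp only [map_sub, map_smul, hb] at this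
  exact sub_left_inj.1 this

theorem IsIsom.inner_map_map {U : H →L[ℂ] H} (hU : IsIsom U) (x y : H) :
    ⟪U x, U y⟫_ℂ = ⟪x, y⟫_ℂ := by
  rw [← ContinuousLinearMap.adjoint_inner_right]
  exact congrArg (inner ℂ x) (DFunLike.congr_fun hU y)

/-- The common core of both claims. Conjugation sends `|ψ⟩⟨ψ|` to `|V ψ⟩⟨V ψ|` and `|U ψ⟩⟨U ψ|`, and
`U ψ ≠ 0` since `U` is isometric, so pure inputs already determine `V`. -/
theorem exists_eq_tensorKet_comp_of_isPartialTrace {V : H →L[ℂ] HTensor H A} {U : H →L[ℂ] H}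
    (hU : IsIsom U)
    (hV : ∀ ρ : H →L[ℂ] H, IsPure ρ → ∃ c : ℂ, IsPartialTrace (conj V ρ) (c • conj U ρ)) :
    ∃ b : A, V = tensorKet H b ∘L U := by
  refine exists_eq_tensorKet_comp hU.inner_map_map fun ψ hψ => ?_
  obtain ⟨c, hc⟩ := hV _ ⟨ψ, hψ, rfl⟩
  rw [conj_ketbra, conj_ketbra] at hc
  refine hc.exists_eq_tensorKet fun h => hψ ?_
  rw [← inner_self_eq_zero (𝕜 := ℂ), ← hU.inner_map_map, h, inner_zero_left]

theorem IsDensity.tensorKetbra {ρ : H →L[ℂ] H} (hρ : IsDensity ρ) {a : A} (ha : ‖a‖ = 1) :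
    IsDensity (tensorKetbra ρ a) :=
  hρ.conj_of_enorm fun x => by rw [enorm_tensorKet, ← ofReal_norm, ha]; simp

theorem tr_conj_tensorKet_comp {U : H →L[ℂ] H} (hU : IsIsom U) (b : A) {ρ : H →L[ℂ] H}
    (hρ : ρ.IsPositive) : tr (conj (tensorKet H b ∘L U) ρ) = ‖b‖ ^ 2 * tr ρ := by
  have hn : ∀ x, ‖U x‖ₑ = ‖x‖ₑ := fun x => by
    rw [← ofReal_norm, ← ofReal_norm, @norm_eq_sqrt_re_inner ℂ, hU.inner_map_map,
      ← @norm_eq_sqrt_re_inner ℂ]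
  rw [tr, etrace_conj_eq_mul (c := ‖b‖ₑ) (fun x => by
    rw [ContinuousLinearMap.comp_apply, enorm_tensorKet, hn]) hρ]
  simp [tr]

theorem tr_tensorKetbra {ρ : H →L[ℂ] H} (hρ : ρ.IsPositive) {a : A} (ha : ‖a‖ = 1) :
    tr (tensorKetbra ρ a) = tr ρ := by
  -- Tensoring with `|a⟩⟨a|` is the case `U = Id`, `b = a`.
  have h1 : IsIsom (1 : H →L[ℂ] H) := by
    rw [IsIsom, mul_one, ← ContinuousLinearMap.star_eq_adjoint, star_one]
  have h := tr_conj_tensorKet_comp h1 a hρ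
  rwa [ha, one_pow, one_mul] at h

end Tensor

/-! ### Circuits as single operators. -/

section Circuit

variable {K K' : Type*} [NormedAddCommGroup K] [InnerProductSpace ℂ K] [CompleteSpace K]
  [NormedAddCommGroup K'] [InnerProductSpace ℂ K'] [CompleteSpace K']

theorem tr_conj_linearIsometryEquiv (e : K ≃ₗᵢ[ℂ] K') {σ : K →L[ℂ] K} (hσ : σ.IsPositive) :
    tr (conj (e : K →L[ℂ] K') σ) = tr σ := by
  rw [tr, etrace_conj_eq_mul (c := 1) (fun x => ?_) hσ]
  · simp [tr]
  · rw [one_mul]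
    exact e.toLinearIsometry.enorm_map x

theorem QCircuit.outState_eq (C : QCircuit K) (μ : C.Path) (σ : K →L[ℂ] K) :
    C.outState μ σ = conj ((C.output.symm : C.S.FullSpace →L[ℂ] K) ∘L
      cumulative μ.ops ∘L (C.input : K →L[ℂ] C.S.FullSpace)) σ := by
  rw [outState, runState_eq_conj, initial, conj_conj, conj_conj,
    ContinuousLinearMap.comp_assoc]

/-- The input and output layouts are unitary and so preserve traces; the rest is the telescoping of
`runProb_eq`. -/
theorem QCircuit.prob_eq (C : QCircuit K) (μ : C.Path) {σ : K →L[ℂ] K} (hσ : IsDensity σ) :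
    C.prob μ σ = tr (C.outState μ σ) / tr σ := by
  have hi : IsDensity (C.initial σ) := hσ.conj_of_enorm C.input.toLinearIsometry.enorm_map
  have hp : (conj (cumulative μ.ops) (C.initial σ)).IsPositive := hi.pos.conj_adjoint _
  rw [prob, runProb_eq _ hi, outState, runState_eq_conj,
    tr_conj_linearIsometryEquiv C.output.symm hp]
  exact congrArg _ (tr_conj_linearIsometryEquiv C.input hσ.pos)

end Circuit

end QIndep

/-! ### The theorem. -/

open QIndep in

theorem theoremB1 {H A : Type*}
    [NormedAddCommGroup H] [InnerProductSpace ℂ H] [CompleteSpace H]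
    [TopologicalSpace.SeparableSpace H]
    [NormedAddCommGroup A] [InnerProductSpace ℂ A] [CompleteSpace A]
    [TopologicalSpace.SeparableSpace A]
    (hH : 2 ≤ Module.rank ℂ H) (a : A) (ha : ‖a‖ = 1)
    (U : H →L[ℂ] H) (hU : QIndep.IsIsom U) :
    (∀ (C : QIndep.QCircuit (QIndep.HTensor H A)) (μ : C.Path),
      (∀ ρ : H →L[ℂ] H, QIndep.IsDensity ρ → C.Computes μ a U ρ) →
      ∀ ρ ρ' : H →L[ℂ] H, QIndep.IsDensity ρ → QIndep.IsDensity ρ' →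
        C.prob μ (QIndep.tensorKetbra ρ a) = C.prob μ (QIndep.tensorKetbra ρ' a)) ∧
    (∀ (n : ℕ) (T : QIndep.MeasTree (QIndep.HTensor H A) n) (β : T.Branch),
      (∀ ρ : H →L[ℂ] H, QIndep.IsPure ρ → T.Computes β a U ρ) →
      (∃ b : A, QIndep.tr (QIndep.ketbra b) = ‖b‖ ^ 2 ∧
        ∀ ρ : H →L[ℂ] H, QIndep.IsDensity ρ →
          QIndep.conj (T.cumOp β) (QIndep.tensorKetbra ρ a) =
              QIndep.tensorKetbra (QIndep.conj U ρ) b ∧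
            T.prob β (QIndep.tensorKetbra ρ a) = QIndep.tr (QIndep.ketbra b)) ∧
      ((∃ ρ : H →L[ℂ] H, QIndep.IsDensity ρ ∧ 0 < T.prob β (QIndep.tensorKetbra ρ a)) →
        ∀ ρ : H →L[ℂ] H, QIndep.IsDensity ρ → 0 < T.prob β (QIndep.tensorKetbra ρ a))) := by
  refine ⟨fun C μ hC => ?_, fun n T β hT => ?_⟩
  · obtain ⟨b, hb⟩ := exists_eq_tensorKet_comp_of_isPartialTrace (A := A) hU
      (V := ((C.output.symm : C.S.FullSpace →L[ℂ] HTensor H A) ∘L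
        cumulative μ.ops ∘L (C.input : HTensor H A →L[ℂ] C.S.FullSpace)) ∘L tensorKet H a)
      -- Pure density operators suffice here too; mixed inputs enter only through the trace
      -- computation in `hp`.
      fun ρ hρ => by
        obtain ⟨c, hc⟩ := hC ρ hρ.isDensity
        rw [C.outState_eq, tensorKetbra, conj_conj] at hc
        exact ⟨c, hc⟩
    have hp : ∀ ρ, IsDensity ρ → C.prob μ (tensorKetbra ρ a) = ‖b‖ ^ 2 := fun ρ hρ => by
      rw [C.prob_eq μ (hρ.tensorKetbra ha), tr_tensorKetbra hρ.pos ha, C.outState_eq,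
        tensorKetbra, conj_conj, hb, tr_conj_tensorKet_comp hU b hρ.pos,
        mul_div_cancel_right₀ _ hρ.tr_pos.ne']
    exact fun ρ ρ' hρ hρ' => (hp ρ hρ).trans (hp ρ' hρ').symm
  · obtain ⟨b, hb⟩ := exists_eq_tensorKet_comp_of_isPartialTrace (A := A) hU
      (V := T.cumOp β ∘L tensorKet H a) fun ρ hρ => by
        obtain ⟨c, hc⟩ := hT ρ hρ
        rw [tensorKetbra, conj_conj] at hc
        exact ⟨c, hc⟩
    have hc : ∀ ρ, conj (T.cumOp β) (tensorKetbra ρ a) = conj (tensorKet H b ∘L U) ρ :=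
      fun ρ => by rw [tensorKetbra, conj_conj, hb]
    -- The trace of the final state is `‖b‖ ^ 2 * tr ρ`, and that of the initial state is `tr ρ`
    -- because `‖a‖ = 1`.
    have hp : ∀ ρ, IsDensity ρ → T.prob β (tensorKetbra ρ a) = ‖b‖ ^ 2 := fun ρ hρ => by
      rw [MeasTree.prob, runProb_eq _ (hρ.tensorKetbra ha), tr_tensorKetbra hρ.pos ha]
      refine (congrArg (fun t => tr t / tr ρ) (hc ρ)).trans ?_
      rw [tr_conj_tensorKet_comp hU b hρ.pos, mul_div_cancel_right₀ _ hρ.tr_pos.ne']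
    refine ⟨⟨b, tr_ketbra b, fun ρ hρ => ⟨?_, ?_⟩⟩, fun ⟨ρ, hρ, h⟩ ρ' hρ' => ?_⟩
    · rw [hc, tensorKetbra, conj_conj]
    · rw [hp ρ hρ, tr_ketbra]
    · rwa [hp ρ' hρ', ← hp ρ hρ]
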